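/- Let $n\ge 0$, $A\in\mathbb H^{n\times n}$, and regard $\mathbb H^n$ as a right $\mathbb H$-module. A standard eigenvalue of $A$ is a complex number $\lambda$ with $\operatorname{Im}\lambda\ge 0$ such that $Av=v\lambda$ for some $v\ne 0$. Write $A=A_1+A_2\boldsymbol j$ with complex $A_1,A_2$ and let $\phi(A)=\begin{pmatrix}A_1&A_2\\-\overline{A_2}&\overline{A_1}\end{pmatrix}\in\mathbb C^{2n\times 2n}$; the multiplicity of a standard eigenvalue $\lambda$ is its algebraic multiplicity as an eigenvalue of $\phi(A)$ if $\lambda\notin\mathbb R$, and half of that if $\lambda\in\mathbb R$. **Theorem 6.4.** $A$ has finitely many standard eigenvalues; let $\lambda_1,\dots,\lambda_k$ be the distinct ones and $n_1,\dots,n_k$ their multiplicities. Then $n_1+\dots+n_k=n$. A system of Jordan chains of $A$ consists of integers $r_j\ge 0$ ($1\le j\le k$) and $m_{ji}\ge 1$ ($1\le i\le r_j$) and vectors $v_1^{ji},\dots,v_{m_{ji}}^{ji}\in\mathbb H^n$ such that $$Av_1^{ji}=v_1^{ji}\lambda_j,\qquad Av_l^{ji}-v_l^{ji}\lambda_j=v_{l-1}^{ji}\quad(2\le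 l\le m_{ji}),$$ and such that, for every $j$, the eigenvectors $v_1^{j1},\dots,v_1^{jr_j}$ are right linearly independent over $\mathbb H$. It is complete if $\sum_{j}\sum_i m_{ji}=n$. Put $N_{\lambda_j}^{m_{ji}}=\{\sum_{l=1}^{m_{ji}}v_l^{ji}r_l : r_l\in\mathbb H\}$. 1. A complete system of Jordan chains of $A$ exists. 2. For every complete system of Jordan chains, $\sum_{i=1}^{r_j}m_{ji}=n_j$ for every $j$ (in particular $r_j\le n_j$ and $m_{ji}\le n_j$), and $\mathbb H^n$ is the direct sum of right submodules $$\mathbb H^n=\bigoplus_{j=1}^k\bigoplus_{i=1}^{r_j}N_{\lambda_j}^{m_{ji}} .$$ 3. For every complete system of Jordan chains, every $\eta\in\mathbb H^n$ can be written in exactly one way as $\eta=\sum_{j=1}^k\sum_{i=1}^{r_j}\sum_{l=1}^{m_{ji}}v_l^{ji}r_l^{ji}$ with $r_l^{ji}\in\mathbb H$, and then, for all $t\in\mathbb R$, $$\exp(At)\,\eta=\sum_{j=1}^k\sum_{i=1}^{r_j}\sum_{l=1}^{m_{ji}}\Bigl(v_l^{ji}+t\,v_{l-1}^{ji}+\frac{t^2}{2!}v_{l-2}^{ji}+\dots+\frac{t^{l-1}}{(l-1)!}v_1^{ji}\Bigr)e^{\lambda_jt}\,r_l^{ji}.$$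 4. A function $x:\mathbb R\to\mathbb H^n$ satisfies $\dot x(t)=Ax(t)$ for all $t\in\mathbb R$ if and only if $x(t)=\exp(At)\,\eta$ for some $\eta\in\mathbb H^n$; hence every solution has the form displayed in 3. -/

import Mathlib

open scoped Quaternion

noncomputable section

/-- Right multiplication of a vector of quaternions by a quaternion, `v * q` entrywise.
This is the scalar action of the right `ℍ`-module `ℍⁿ`, which Mathlib sees as a module over the
opposite ring. -/
abbrev rmul {n : ℕ} (v : Fin n → ℍ[ℝ]) (q : ℍ[ℝ]) : Fin n → ℍ[ℝ] :=
  MulOpposite.op q • v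

/-- `z` is a standard (right) eigenvalue of `A`: a complex number with nonnegative imaginary part
such that `A v = v z` for some nonzero `v`. -/
def IsStandardEigenvalue {n : ℕ} (A : Matrix (Fin n) (Fin n) ℍ[ℝ]) (z : ℂ) : Prop :=
  0 ≤ z.im ∧ ∃ v : Fin n → ℍ[ℝ], v ≠ 0 ∧ A.mulVec v = rmul v (z : ℍ[ℝ])

/-- The complex adjoint matrix of `A = A₁ + A₂ j`, with `A₁` and `A₂` complex, is the block matrix
with rows `(A₁, A₂)` and `(-conj A₂, conj A₁)`. -/
def complexAdjoint {n : ℕ} (A : Matrix (Fin n) (Fin n) ℍ[ℝ]) :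
    Matrix (Fin n ⊕ Fin n) (Fin n ⊕ Fin n) ℂ :=
  let A₁ : Matrix (Fin n) (Fin n) ℂ := A.map fun q => ⟨q.re, q.imI⟩
  let A₂ : Matrix (Fin n) (Fin n) ℂ := A.map fun q => ⟨q.imJ, q.imK⟩
  Matrix.fromBlocks A₁ A₂ (-A₂.map (starRingEnd ℂ)) (A₁.map (starRingEnd ℂ))

open Classical in
/-- Multiplicity of a standard eigenvalue: the algebraic multiplicity for the complex adjoint
matrix if the eigenvalue is not real, and half of it if the eigenvalue is real. -/
def standardMultiplicity {n : ℕ} (A : Matrix (Fin n) (Fin n) ℍ[ℝ]) (z : ℂ) : ℕ :=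
  if z.im = 0 then (complexAdjoint A).charpoly.rootMultiplicity z / 2
  else (complexAdjoint A).charpoly.rootMultiplicity z

/-- A family of Jordan chains of `A` for the complex numbers `μ 0, …, μ (k - 1)`: for every `j`
there are `r j` chains, the `i`-th one having length `m j i ≥ 1`. The vectors of a chain are
numbered from `0`, so `v j i ⟨0, _⟩` is the eigenvector on which the chain is based. For each `j`,
these eigenvectors are right independent. -/
structure JordanChains {n k : ℕ} (A : Matrix (Fin n) (Fin n) ℍ[ℝ]) (μ : Fin k → ℂ) where
  r : Fin k → ℕ
  m : (j : Fin k) → Fin (r j) → ℕ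
  m_pos : ∀ j i, 0 < m j i
  v : (j : Fin k) → (i : Fin (r j)) → Fin (m j i) → (Fin n → ℍ[ℝ])
  eigenvector : ∀ j i,
    A.mulVec (v j i ⟨0, m_pos j i⟩) = rmul (v j i ⟨0, m_pos j i⟩) (μ j : ℍ[ℝ])
  chain : ∀ j i (l : ℕ) (hl : l + 1 < m j i),
    A.mulVec (v j i ⟨l + 1, hl⟩) - rmul (v j i ⟨l + 1, hl⟩) (μ j : ℍ[ℝ]) =
      v j i ⟨l, Nat.lt_of_succ_lt hl⟩
  independent : ∀ j, LinearIndependent (ℍ[ℝ])ᵐᵒᵖ fun i => v j i ⟨0, m_pos j i⟩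

namespace JordanChains

variable {n k : ℕ} {A : Matrix (Fin n) (Fin n) ℍ[ℝ]} {μ : Fin k → ℂ}

/-- The family is complete: the lengths of all its chains add up to `n`. -/
def IsComplete (S : JordanChains A μ) : Prop :=
  ∑ j, ∑ i, S.m j i = n

/-- The right submodule spanned by the `i`-th chain for `μ j`. -/
def N (S : JordanChains A μ) (j : Fin k) (i : Fin (S.r j)) :
    Submodule (ℍ[ℝ])ᵐᵒᵖ (Fin n → ℍ[ℝ]) :=
  Submodule.span (ℍ[ℝ])ᵐᵒᵖ (Set.range (S.v j i))

/-- `(v_l + t v_{l-1} + t² / 2! v_{l-2} + ⋯) e^{μ_j t}`, where the sum ends with the eigenvector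
on which the chain is based. -/
def chainSolution (S : JordanChains A μ) (j : Fin k) (i : Fin (S.r j)) (l : Fin (S.m j i))
    (t : ℝ) : Fin n → ℍ[ℝ] :=
  rmul (∑ p ∈ Finset.Iic l,
      (t ^ ((l : ℕ) - (p : ℕ)) / (Nat.factorial ((l : ℕ) - (p : ℕ)) : ℝ)) • S.v j i p)
    ((Complex.exp (μ j * (t : ℂ)) : ℂ) : ℍ[ℝ])

end JordanChains

/-- `x` solves `x' = A x` on the real line. -/
def IsSolution {n : ℕ} (A : Matrix (Fin n) (Fin n) ℍ[ℝ]) (x : ℝ → Fin n → ℍ[ℝ]) : Prop :=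
  ∀ t : ℝ, HasDerivAt x (A.mulVec (x t)) t

end

/-! With complex scalars acting on the right, `ℍⁿ` is a complex space of dimension `2n` on which `A`
acts with matrix `complexAdjoint A`. Standard eigenvalues are therefore the roots of its
characteristic polynomial in the closed upper half-plane. Right multiplication by `j` commutes with
`A` and is conjugate linear, so it exchanges the generalized eigenspaces of `z` and of its
conjugate. Nonreal roots thus pair off with equal multiplicities, while the generalized eigenspace
of a real root is a right `ℍ`-space and has even complex dimension. Counting the `2n` roots gives
`sum_standardMultiplicity`.

Chains are built one eigenvalue at a time from the Jordan form of a nilpotent map over a division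
ring. A real `z` is central, so `A - z` is right linear and the construction runs over `ℍ`. For
nonreal `z` it runs over `ℂ`; complex independent eigenvectors `v` stay independent over `ℍ`,
because the vectors `v` and `v j` belong to different eigenvalues.

For an arbitrary system, the chains and their multiples by `j` are complex Jordan chains. They are
independent by the usual theory, and `LinearIndependent.of_basis_smul` carries this back to `ℍ`.
Dimensions of generalized eigenspaces bound the lengths for each eigenvalue by its multiplicity. In
a complete system both totals are `n`, so the bounds are equalities and the chain vectors form a
basis. The exponential formula follows by uniqueness for `x' = A x`. -/

/-! ### Jordan chains and linear independence over general rings and fields -/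

/-- A nilpotent endomorphism of a finite-dimensional space over a division ring has Jordan chains
with independent initial vectors whose lengths add up to the dimension. -/
theorem exists_jordanChains_of_isNilpotent {D : Type*} [DivisionRing D] :
    ∀ (d : ℕ) {V : Type*} [AddCommGroup V] [Module D V] [FiniteDimensional D V]
      (N : Module.End D V), IsNilpotent N → Module.finrank D V = d →
      ∃ (r : ℕ) (m : Fin r → ℕ) (v : Fin r → ℕ → V), (∀ i, 0 < m i) ∧ (∀ i, N (v i 0) = 0) ∧
        (∀ i l, l + 1 < m i → N (v i (l + 1)) = v i l) ∧
        LinearIndependent D (fun i => v i 0) ∧ ∑ i, m i = Module.finrank D V := by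
  intro d
  induction d using Nat.strong_induction_on with
  | _ d ih =>
  intro V _ _ _ N hN hd
  by_cases hd0 : d = 0
  · refine ⟨0, Fin.elim0, Fin.elim0, fun i => i.elim0, fun i => i.elim0, fun i => i.elim0,
      linearIndependent_empty_type, ?_⟩
    simp [hd, hd0]
  have hlt : Module.finrank D (LinearMap.range N) < d := by
    rw [← hd]
    refine Submodule.finrank_lt fun htop => hd0 ?_
    obtain ⟨k, hk⟩ := hN
    have hs : Function.Surjective (N ^ k) := by
      rw [Module.End.coe_pow]
      exact (LinearMap.range_eq_top.mp htop).iterate k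
    rw [hk] at hs
    have : Subsingleton V := ⟨fun a b => by
      obtain ⟨a, rfl⟩ := hs a
      obtain ⟨b, rfl⟩ := hs b
      simp⟩
    rw [← hd]
    exact Module.finrank_zero_of_subsingleton
  have hmaps : ∀ x ∈ LinearMap.range N, N x ∈ LinearMap.range N := fun x _ => ⟨x, rfl⟩
  have hN' : IsNilpotent (N.restrict hmaps) := by
    obtain ⟨k, hk⟩ := hN
    refine ⟨k, ?_⟩
    rw [Module.End.pow_restrict k hmaps]
    ext x
    simp [hk]
  obtain ⟨r, m, v, hm, h0, hs, hi, hsum⟩ := ih _ hlt (N.restrict hmaps) hN' rfl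
  have hv0 : ∀ i, N (v i 0 : V) = 0 := fun i => congrArg Subtype.val (h0 i)
  have hvs : ∀ i l, l + 1 < m i → N (v i (l + 1) : V) = v i l := fun i l hl =>
    congrArg Subtype.val (hs i l hl)
  -- The induction supplies chains in the range of `N`. A preimage of the last vector of each chain
  -- prolongs it by one.
  choose w hw using fun i => (v i (m i - 1)).2
  have hker : LinearIndependent D
      (fun i => (⟨v i 0, LinearMap.mem_ker.2 (hv0 i)⟩ : LinearMap.ker N)) := by
    refine LinearIndependent.of_comp (LinearMap.ker N).subtype ?_
    exact hi.map' (LinearMap.range N).subtype (Submodule.ker_subtype _)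
  -- The initial vectors lie in the kernel and extend to a basis of it; each added basis vector is a
  -- chain of length one.
  let b := Module.Basis.sumExtend hker
  have : Finite (Fin r ⊕ Module.Basis.sumExtendIndex hker) := Module.Finite.finite_basis b
  have : Finite (Module.Basis.sumExtendIndex hker) := Finite.sum_right (Fin r)
  have : Fintype (Module.Basis.sumExtendIndex hker) := Fintype.ofFinite _
  have hcard := Module.finrank_eq_card_basis b
  let e := Fintype.equivFin (Fin r ⊕ Module.Basis.sumExtendIndex hker)
  let m' : Fin r ⊕ Module.Basis.sumExtendIndex hker → ℕ := Sum.elim (fun i => m i + 1) fun _ => 1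
  let v' : Fin r ⊕ Module.Basis.sumExtendIndex hker → ℕ → V :=
    Sum.elim (fun i l => if l < m i then v i l else w i) fun u _ => b (Sum.inr u)
  have hb : ∀ x, v' x 0 = b x := by
    rintro (i | u)
    · simp only [v', Sum.elim_inl, hm i, if_true, b, Module.Basis.sumExtend,
        Module.Basis.reindex_apply, Module.Basis.extend_apply_self]
      rfl
    · rfl
  refine ⟨_, m' ∘ e.symm, v' ∘ e.symm, fun i => ?_, fun i => ?_, fun i => ?_, ?_, ?_⟩
  · simp only [Function.comp_apply]
    rcases e.symm i with j | u <;> simp [m']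
  · simp only [Function.comp_apply, hb]
    exact (b _).2
  · simp only [Function.comp_apply]
    rcases e.symm i with j | u
    · intro l hl
      have hl : l < m j := by simpa [m'] using hl
      by_cases h : l + 1 < m j
      · simp [v', h, hl, hvs j l h]
      · have : l = m j - 1 := by omega
        subst this
        simp [v', h, hl, hw]
    · intro l hl
      simp [m'] at hl
  · simp only [Function.comp_apply, hb]
    exact (b.linearIndependent.map' (LinearMap.ker N).subtype
      (Submodule.ker_subtype _)).comp e.symm e.symm.injective
  -- Rank-nullity: the old lengths add up to the rank, and each chain, prolonged or new, adds one,
  -- once for every basis vector of the kernel.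
  · rw [← LinearMap.finrank_range_add_finrank_ker N, hcard, ← hsum]
    refine (Equiv.sum_comp e.symm m').trans ?_
    simp [m', Finset.sum_add_distrib]
    ring

/-- Jordan chains of an endomorphism on the kernel of one of its powers. -/
theorem exists_jordanChains_ker_pow {D V : Type*} [DivisionRing D] [AddCommGroup V] [Module D V]
    [FiniteDimensional D V] (N : Module.End D V) (p : ℕ) :
    ∃ (r : ℕ) (m : Fin r → ℕ) (v : Fin r → ℕ → V), (∀ i, 0 < m i) ∧ (∀ i, N (v i 0) = 0) ∧
      (∀ i l, l + 1 < m i → N (v i (l + 1)) = v i l) ∧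
      LinearIndependent D (fun i => v i 0) ∧
      ∑ i, m i = Module.finrank D (LinearMap.ker (N ^ p)) := by
  have hmaps : ∀ x ∈ LinearMap.ker (N ^ p), N x ∈ LinearMap.ker (N ^ p) := fun x hx => by
    rw [LinearMap.mem_ker] at hx ⊢
    rw [← Module.End.mul_apply, ← pow_succ, pow_succ', Module.End.mul_apply, hx, map_zero]
  have hN' : IsNilpotent (N.restrict hmaps) := by
    refine ⟨p, ?_⟩
    rw [Module.End.pow_restrict p hmaps]
    ext x
    exact x.2
  obtain ⟨r, m, v, hm, h0, hs, hi, hsum⟩ := exists_jordanChains_of_isNilpotent _ _ hN' rfl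
  exact ⟨r, m, fun i l => v i l, hm, fun i => congrArg Subtype.val (h0 i),
    fun i l hl => congrArg Subtype.val (hs i l hl),
    hi.map' (LinearMap.ker (N ^ p)).subtype (Submodule.ker_subtype _), hsum⟩

/-- Vectors taken from independent submodules are independent as soon as those taken from each
single submodule are. -/
theorem iSupIndep.linearIndependent_of_fibers {R V ι κ : Type*} [Ring R] [AddCommGroup V]
    [Module R V] [Fintype κ] {W : ι → Submodule R V} (hW : iSupIndep W) (e : κ → ι) (x : κ → V)
    (hx : ∀ a, x a ∈ W (e a))
    (h : ∀ i, LinearIndependent R fun a : {a // e a = i} => x a) : LinearIndependent R x := by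
  classical
  rw [Fintype.linearIndependent_iff]
  intro c hc a
  have key := (iSupIndep_iff_finsetSum_eq_zero_imp_eq_zero W).1 hW (Finset.univ.image e)
    (fun i => ∑ a with e a = i, c a • x a)
    (fun i _ => Submodule.sum_mem _ fun a ha => by
      obtain rfl := (Finset.mem_filter.1 ha).2
      exact Submodule.smul_mem _ _ (hx a))
    (by
      rw [← hc]
      exact Finset.sum_fiberwise_of_maps_to
        (fun a _ => Finset.mem_image_of_mem e (Finset.mem_univ a)) fun a => c a • x a)
    (e a) (Finset.mem_image_of_mem _ (Finset.mem_univ _))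
  have h' := Fintype.linearIndependent_iff.1 (h (e a)) (fun b => c b) (by
    rw [← key]
    exact (Finset.sum_subtype _ (by simp) fun b => c b • x b).symm)
  exact h' ⟨a, rfl⟩

/-- The vectors of finitely many chains of a linear map are independent as soon as the initial
vectors are. -/
theorem linearIndependent_chains {R V κ : Type*} [Ring R] [AddCommGroup V] [Module R V]
    [Fintype κ] (N : Module.End R V) (m : κ → ℕ) (v : κ → ℕ → V)
    (h0 : ∀ i, N (v i 0) = 0) (hs : ∀ i l, l + 1 < m i → N (v i (l + 1)) = v i l)
    (hi : LinearIndependent R fun i => v i 0) :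
    LinearIndependent R fun p : (Σ i, Fin (m i)) => v p.1 p.2 := by
  classical
  have hpow : ∀ L i l, l < m i → (N ^ L) (v i l) = if L ≤ l then v i (l - L) else 0 := by
    intro L
    induction L with
    | zero => simp
    | succ L ih =>
      intro i l hl
      rw [pow_succ, Module.End.mul_apply]
      rcases l with _ | l
      · simp [h0]
      · rw [hs i l hl, ih i l (by omega)]
        simp
  rw [Fintype.linearIndependent_iff]
  intro c hc
  by_contra! hne
  obtain ⟨p, hp⟩ := hne
  -- Take a nonzero coefficient at maximal height and apply `N` that many times: lower vectors die,
  -- higher ones have coefficient zero, and those at this height become initial vectors.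
  obtain ⟨q, hq, hmax⟩ := Finset.exists_max_image
    (Finset.univ.filter fun p : (Σ i, Fin (m i)) => c p ≠ 0) (fun p => (p.2 : ℕ))
    ⟨p, by simpa using hp⟩
  simp only [Finset.mem_filter, Finset.mem_univ, true_and] at hq hmax
  have key := congrArg (N ^ (q.2 : ℕ)) hc
  rw [map_zero, map_sum, Fintype.sum_sigma] at key
  have := Fintype.linearIndependent_iff.1 hi
    (fun i => if h : (q.2 : ℕ) < m i then c ⟨i, ⟨q.2, h⟩⟩ else 0) (by
      rw [← key]
      refine Finset.sum_congr rfl fun i _ => ?_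
      simp only [map_smul]
      by_cases h : (q.2 : ℕ) < m i
      · rw [Finset.sum_eq_single ⟨q.2, h⟩]
        · simp [h, hpow]
        · intro l _ hl
          rcases lt_trichotomy (l : ℕ) q.2 with h1 | h1 | h1
          · rw [hpow _ _ _ l.2, if_neg (by omega), smul_zero]
          · exact absurd (Fin.ext h1) hl
          · have : c ⟨i, l⟩ = 0 := by
              by_contra hc
              exact absurd (hmax _ hc) (not_le.2 h1)
            rw [this, zero_smul]
        · simp
      · simp only [h, dite_false, zero_smul]
        refine (Finset.sum_eq_zero fun l _ => ?_).symm
        rw [hpow _ _ _ l.2, if_neg (by omega), smul_zero]) q.1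
  rw [dif_pos q.2.2] at this
  exact hq this

/-- If all products of the members of a basis of `S` over `R` with the members of a family are
independent over `R`, then the family is independent over `S`. -/
theorem LinearIndependent.of_basis_smul {R S V ι κ : Type*} [Ring R] [Ring S]
    [AddCommGroup V] [Module R S] [Module S V] [Module R V] [IsScalarTower R S V] [Fintype ι]
    [Fintype κ] (b : Module.Basis ι R S) {v : κ → V}
    (h : LinearIndependent R fun p : ι × κ => b p.1 • v p.2) : LinearIndependent S v := by
  rw [Fintype.linearIndependent_iff] at h ⊢
  intro c hc k
  have := h (fun p => b.repr (c p.2) p.1) (by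
    rw [← hc, Fintype.sum_prod_type_right]
    refine Finset.sum_congr rfl fun k _ => ?_
    conv_rhs => rw [← b.sum_repr (c k), Finset.sum_smul]
    simp only [smul_assoc])
  rw [← b.sum_repr (c k)]
  exact Finset.sum_eq_zero fun i _ => by rw [this (i, k), zero_smul]

/-- The vectors of a Jordan chain are generalized eigenvectors. -/
theorem mem_maxGenEigenspace_of_chain {K V : Type*} [CommRing K] [AddCommGroup V] [Module K V]
    (T : Module.End K V) (e : K) (m : ℕ) (v : ℕ → V) (h0 : T (v 0) = e • v 0)
    (hs : ∀ l, l + 1 < m → T (v (l + 1)) = e • v (l + 1) + v l) :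
    ∀ l, l < m → v l ∈ T.maxGenEigenspace e := by
  intro l hl
  refine Module.End.mem_maxGenEigenspace T e _ |>.2 ⟨l + 1, ?_⟩
  induction l with
  | zero => simp [h0]
  | succ l ih =>
    have : (T - e • 1) (v (l + 1)) = v l := by simp [hs l hl]
    rw [pow_succ, Module.End.mul_apply, this]
    exact ih (by omega)

/-- Jordan chains of an endomorphism for various eigenvalues: all their vectors are independent as
soon as, for each eigenvalue, the initial eigenvectors are. -/
theorem linearIndependent_jordanChains {K V κ : Type*} [Field K] [AddCommGroup V] [Module K V]
    [Fintype κ] (T : Module.End K V) (e : κ → K) (m : κ → ℕ) (v : κ → ℕ → V)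
    (h0 : ∀ i, T (v i 0) = e i • v i 0)
    (hs : ∀ i l, l + 1 < m i → T (v i (l + 1)) = e i • v i (l + 1) + v i l)
    (hi : ∀ z, LinearIndependent K fun i : {i // e i = z} => v i 0) :
    LinearIndependent K fun p : (Σ i, Fin (m i)) => v p.1 p.2 := by
  classical
  have hmem' : ∀ p : (Σ i, Fin (m i)), v p.1 p.2 ∈ T.maxGenEigenspace (e p.1) :=
    fun p =>
      mem_maxGenEigenspace_of_chain T (e p.1) (m p.1) (v p.1) (h0 p.1) (hs p.1) p.2 p.2.2
  refine iSupIndep.linearIndependent_of_fibers T.independent_maxGenEigenspace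
    (fun p : (Σ i, Fin (m i)) => e p.1) (fun p => v p.1 p.2) hmem' ?_
  intro z
  have := linearIndependent_chains (T - z • 1) (fun i : {i // e i = z} => m i) (fun i l => v i l)
    (fun i => by simp [h0, i.2]) (fun i l hl => by simp [hs _ l hl, i.2]) (hi z)
  let f : {p : (Σ i, Fin (m i)) // e p.1 = z} → Σ i : {i // e i = z}, Fin (m i) :=
    fun p => ⟨⟨p.1.1, p.2⟩, p.1.2⟩
  have hf : Function.LeftInverse (fun q => ⟨⟨q.1.1, q.2⟩, q.1.2⟩) f := fun _ => rfl
  exact this.comp f hf.injective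

/-! ### The complex structure on `ℍⁿ`, the complex adjoint matrix and multiplicities -/

noncomputable section

/-- Right multiplication by complex numbers makes the quaternions a complex vector space. -/
abbrev quaternionComplexModule : Module ℂ ℍ[ℝ] :=
  Module.compHom ℍ[ℝ] ((Quaternion.ofComplex : ℂ →+* ℍ[ℝ]).toOpposite fun x y => by
    rw [Commute, SemiconjBy, ← map_mul, mul_comm, map_mul])

section RightModule

attribute [local instance] quaternionComplexModule

theorem complex_smul_quaternion (z : ℂ) (q : ℍ[ℝ]) : z • q = q * (z : ℍ[ℝ]) := rfl

theorem complex_smul_eq_rmul {n : ℕ} (z : ℂ) (v : Fin n → ℍ[ℝ]) : z • v = rmul v z := rfl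

theorem complex_smul_op (z : ℂ) (q : ℍ[ℝ]ᵐᵒᵖ) : z • q = MulOpposite.op (q.unop * (z : ℍ[ℝ])) := rfl

instance isScalarTower_complex_op {n : ℕ} : IsScalarTower ℂ ℍ[ℝ]ᵐᵒᵖ (Fin n → ℍ[ℝ]) where
  smul_assoc z q v := by
    ext1 i
    exact (mul_assoc _ _ _).symm

/-- The quaternion unit `j`. -/
def quaternionJ : ℍ[ℝ] := ⟨0, 0, 1, 0⟩

/-- The basis `1, j` of the quaternions as a right complex vector space. -/
def quaternionComplexBasis : Module.Basis (Fin 2) ℂ ℍ[ℝ]ᵐᵒᵖ :=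
  .ofEquivFun
    -- The sign at `imK` comes from `j (x + y i) = x j - y k`.
    { toFun := fun q => ![⟨q.unop.re, q.unop.imI⟩, ⟨q.unop.imJ, -q.unop.imK⟩]
      invFun := fun f => MulOpposite.op (⟨(f 0).re, (f 0).im, (f 1).re, -(f 1).im⟩ : ℍ[ℝ])
      map_add' := fun p q => by
        ext i; fin_cases i <;> apply Complex.ext <;> simp [add_comm]
      map_smul' := fun z q => by
        ext i; fin_cases i <;> apply Complex.ext <;> simp [complex_smul_op] <;> ring
      left_inv := fun q => by
        apply MulOpposite.unop_injective
        ext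
        exacts [rfl, rfl, rfl, neg_neg _]
      right_inv := fun f => by
        ext i; fin_cases i
        exacts [rfl, Complex.ext rfl (neg_neg _)] }

theorem quaternionComplexBasis_zero : quaternionComplexBasis 0 = 1 := by
  apply MulOpposite.unop_injective
  ext <;> simp [quaternionComplexBasis] <;> rfl

theorem quaternionComplexBasis_one :
    quaternionComplexBasis 1 = MulOpposite.op quaternionJ := by
  apply MulOpposite.unop_injective
  ext <;> simp [quaternionComplexBasis] <;> rfl

theorem finrank_complex_op : Module.finrank ℂ ℍ[ℝ]ᵐᵒᵖ = 2 := by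
  simp [Module.finrank_eq_card_basis quaternionComplexBasis]

/-- Coordinates of a vector of quaternions with respect to right multiplication by complex
numbers. -/
def complexCoordinates (n : ℕ) : (Fin n → ℍ[ℝ]) ≃ₗ[ℂ] (Fin n ⊕ Fin n → ℂ) where
  toFun v := Sum.elim (fun i => ⟨(v i).re, (v i).imI⟩) fun i => ⟨-(v i).imJ, (v i).imK⟩
  invFun f i := ⟨(f (.inl i)).re, (f (.inl i)).im, -(f (.inr i)).re, (f (.inr i)).im⟩
  map_add' v w := by
    ext (i | i) <;> apply Complex.ext <;> simp [add_comm]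
  map_smul' z v := by
    ext (i | i) <;> apply Complex.ext <;> simp [complex_smul_quaternion] <;> ring
  left_inv v := by ext i <;> simp
  right_inv f := by ext (i | i) <;> simp

instance finite_complex_quaternion_pi (n : ℕ) : Module.Finite ℂ (Fin n → ℍ[ℝ]) :=
  Module.Finite.equiv (complexCoordinates n).symm

variable {n : ℕ}

theorem complexCoordinates_inl (v : Fin n → ℍ[ℝ]) (i : Fin n) :
    complexCoordinates n v (.inl i) = ⟨(v i).re, (v i).imI⟩ := rfl

theorem complexCoordinates_inr (v : Fin n → ℍ[ℝ]) (i : Fin n) :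
    complexCoordinates n v (.inr i) = ⟨-(v i).imJ, (v i).imK⟩ := rfl

/-- Multiplication of column vectors by a quaternionic matrix is right linear. -/
def quaternionEnd (A : Matrix (Fin n) (Fin n) ℍ[ℝ]) : Module.End ℍ[ℝ]ᵐᵒᵖ (Fin n → ℍ[ℝ]) where
  toFun := A.mulVec
  map_add' := A.mulVec_add
  map_smul' q v := A.mulVec_smul q v

/-- A quaternionic matrix acting on column vectors over the complex numbers. -/
def complexEnd (A : Matrix (Fin n) (Fin n) ℍ[ℝ]) : Module.End ℂ (Fin n → ℍ[ℝ]) :=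
  (quaternionEnd A).restrictScalars ℂ

theorem quaternionEnd_apply (A : Matrix (Fin n) (Fin n) ℍ[ℝ]) (v : Fin n → ℍ[ℝ]) :
    quaternionEnd A v = A.mulVec v := rfl

theorem complexEnd_apply (A : Matrix (Fin n) (Fin n) ℍ[ℝ]) (v : Fin n → ℍ[ℝ]) :
    complexEnd A v = A.mulVec v := rfl

/-- The coordinates of `v = v₁ + v₂ j` are `(v₁, -conj v₂)`, the first block column of the adjoint
of `v`; the identity is multiplicativity of the adjoint, read on that column. -/
theorem complexCoordinates_mulVec (A : Matrix (Fin n) (Fin n) ℍ[ℝ]) (v : Fin n → ℍ[ℝ]) :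
    complexCoordinates n (A.mulVec v) = (complexAdjoint A).mulVec (complexCoordinates n v) := by
  have hre (f : Fin n → ℍ[ℝ]) : (∑ i, f i).re = ∑ i, (f i).re :=
    map_sum (QuaternionAlgebra.reₗ (-1 : ℝ) 0 (-1)) f Finset.univ
  have hI (f : Fin n → ℍ[ℝ]) : (∑ i, f i).imI = ∑ i, (f i).imI :=
    map_sum (QuaternionAlgebra.imIₗ (-1 : ℝ) 0 (-1)) f Finset.univ
  have hJ (f : Fin n → ℍ[ℝ]) : (∑ i, f i).imJ = ∑ i, (f i).imJ :=
    map_sum (QuaternionAlgebra.imJₗ (-1 : ℝ) 0 (-1)) f Finset.univ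
  have hK (f : Fin n → ℍ[ℝ]) : (∑ i, f i).imK = ∑ i, (f i).imK :=
    map_sum (QuaternionAlgebra.imKₗ (-1 : ℝ) 0 (-1)) f Finset.univ
  ext (i | i) <;> apply Complex.ext <;>
    simp [complexAdjoint, Matrix.mulVec, dotProduct, Matrix.fromBlocks,
      complexCoordinates_inl, complexCoordinates_inr,
      hre, hI, hJ, hK, Finset.sum_add_distrib, Finset.sum_sub_distrib, Finset.sum_neg_distrib] <;>
    ring

theorem charpoly_complexEnd (A : Matrix (Fin n) (Fin n) ℍ[ℝ]) :
    (complexEnd A).charpoly = (complexAdjoint A).charpoly := by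
  rw [← Matrix.charpoly_toLin', ← LinearEquiv.charpoly_conj (complexCoordinates n)]
  congr 1
  refine LinearMap.ext fun w => ?_
  obtain ⟨v, rfl⟩ := (complexCoordinates n).surjective w
  rw [LinearEquiv.conj_apply_apply, LinearEquiv.symm_apply_apply, complexEnd_apply,
    complexCoordinates_mulVec, Matrix.toLin'_apply]

theorem finrank_maxGenEigenspace_complexEnd (A : Matrix (Fin n) (Fin n) ℍ[ℝ]) (z : ℂ) :
    Module.finrank ℂ ((complexEnd A).maxGenEigenspace z) =
      (complexAdjoint A).charpoly.rootMultiplicity z := by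
  rw [LinearMap.finrank_maxGenEigenspace_eq, charpoly_complexEnd]

theorem isStandardEigenvalue_iff (A : Matrix (Fin n) (Fin n) ℍ[ℝ]) (z : ℂ) :
    IsStandardEigenvalue A z ↔ 0 ≤ z.im ∧ (complexAdjoint A).charpoly.IsRoot z := by
  rw [← charpoly_complexEnd, ← Module.End.hasEigenvalue_iff_isRoot_charpoly, IsStandardEigenvalue,
    and_congr_right_iff]
  intro _
  constructor
  · rintro ⟨v, hv, h⟩
    exact Module.End.hasEigenvalue_of_hasEigenvector ⟨Module.End.mem_eigenspace_iff.2 h, hv⟩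
  · intro h
    obtain ⟨v, h, hv⟩ := h.exists_hasEigenvector
    exact ⟨v, hv, Module.End.mem_eigenspace_iff.1 h⟩

/-- The complex adjoint matrix is similar to its complex conjugate. -/
theorem charpoly_complexAdjoint_map (A : Matrix (Fin n) (Fin n) ℍ[ℝ]) :
    (complexAdjoint A).charpoly.map (starRingEnd ℂ) = (complexAdjoint A).charpoly := by
  -- In coordinates, right multiplication by `j` is complex conjugation followed by `P`.
  let P : (Matrix (Fin n ⊕ Fin n) (Fin n ⊕ Fin n) ℂ)ˣ :=
    ⟨.fromBlocks 0 1 (-1) 0, .fromBlocks 0 (-1) 1 0,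
      by simp [Matrix.fromBlocks_multiply, Matrix.fromBlocks_one],
      by simp [Matrix.fromBlocks_multiply, Matrix.fromBlocks_one]⟩
  rw [← Matrix.charpoly_map, ← Matrix.charpoly_units_conj P]
  congr 1
  rw [← Matrix.coe_units_inv, Units.mul_inv_eq_iff_eq_mul]
  simp only [P, complexAdjoint, Matrix.fromBlocks_map, Matrix.fromBlocks_multiply]
  congr 1 <;> ext <;> simp

theorem rootMultiplicity_conj (A : Matrix (Fin n) (Fin n) ℍ[ℝ]) (z : ℂ) :
    (complexAdjoint A).charpoly.rootMultiplicity (starRingEnd ℂ z) =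
      (complexAdjoint A).charpoly.rootMultiplicity z := by
  conv_lhs => rw [← charpoly_complexAdjoint_map]
  exact (Polynomial.eq_rootMultiplicity_map (starRingEnd ℂ).injective z).symm

theorem finrank_complex_quaternion_pi (n : ℕ) : Module.finrank ℂ (Fin n → ℍ[ℝ]) = 2 * n := by
  rw [(complexCoordinates n).finrank_eq]
  simp
  ring

/-- Over the real eigenvalues the shifted matrix acts right linearly. -/
theorem quaternionEnd_sub_diagonal (A : Matrix (Fin n) (Fin n) ℍ[ℝ]) {z : ℂ} (hz : z.im = 0)
    (v : Fin n → ℍ[ℝ]) :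
    quaternionEnd (A - Matrix.diagonal fun _ => (z : ℍ[ℝ])) v = (complexEnd A - z • 1) v := by
  have hz' : (z : ℍ[ℝ]) = ((z.re : ℝ) : ℍ[ℝ]) := by ext <;> simp [hz]
  ext1 i
  rw [quaternionEnd_apply, Matrix.sub_mulVec, Pi.sub_apply, Matrix.mulVec_diagonal, hz',
    Quaternion.coe_commutes, ← hz']
  rfl

/-- The generalized eigenspace of a real `z` is a right `ℍ`-subspace, whose complex dimension is
twice its quaternionic one. The exponent `2 * n` is the complex dimension of the whole space, large
enough for the kernels to have stabilized. -/
theorem finrank_ker_pow_of_im_eq_zero (A : Matrix (Fin n) (Fin n) ℍ[ℝ]) {z : ℂ} (hz : z.im = 0) :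
    2 * Module.finrank ℍ[ℝ]ᵐᵒᵖ (LinearMap.ker
      (quaternionEnd (A - Matrix.diagonal fun _ => (z : ℍ[ℝ])) ^ (2 * n))) =
      (complexAdjoint A).charpoly.rootMultiplicity z := by
  rw [← finrank_maxGenEigenspace_complexEnd,
    Module.End.maxGenEigenspace_eq_genEigenspace_finrank, Module.End.genEigenspace_nat,
    finrank_complex_quaternion_pi]
  have h : (LinearMap.ker (quaternionEnd (A - Matrix.diagonal fun _ => (z : ℍ[ℝ])) ^
      (2 * n))).restrictScalars ℂ = LinearMap.ker ((complexEnd A - z • 1) ^ (2 * n)) := by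
    ext v
    rw [Submodule.restrictScalars_mem, LinearMap.mem_ker, LinearMap.mem_ker, Module.End.coe_pow,
      Module.End.coe_pow, funext (quaternionEnd_sub_diagonal A hz)]
  have htower := Module.finrank_mul_finrank ℂ ℍ[ℝ]ᵐᵒᵖ (LinearMap.ker
    (quaternionEnd (A - Matrix.diagonal fun _ => (z : ℍ[ℝ])) ^ (2 * n)))
  rw [finrank_complex_op] at htower
  rw [htower, ← h]
  rfl

/-- The algebraic multiplicity is even here, so the division by two in `ℕ` is exact. -/
theorem two_mul_standardMultiplicity_of_im_eq_zero (A : Matrix (Fin n) (Fin n) ℍ[ℝ]) {z : ℂ}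
    (hz : z.im = 0) :
    2 * standardMultiplicity A z = (complexAdjoint A).charpoly.rootMultiplicity z := by
  rw [standardMultiplicity, if_pos hz, ← finrank_ker_pow_of_im_eq_zero A hz]
  simp

theorem finite_isStandardEigenvalue (A : Matrix (Fin n) (Fin n) ℍ[ℝ]) :
    {z : ℂ | IsStandardEigenvalue A z}.Finite := by
  refine (Polynomial.finite_setOfPred_isRoot
    (complexAdjoint A).charpoly_monic.ne_zero).subset fun z hz => ?_
  exact ((isStandardEigenvalue_iff A z).1 hz).2

theorem sum_standardMultiplicity (A : Matrix (Fin n) (Fin n) ℍ[ℝ]) {k : ℕ} {μ : Fin k → ℂ}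
    (hμ : Function.Injective μ) (h : ∀ z : ℂ, IsStandardEigenvalue A z ↔ ∃ j, μ j = z) :
    ∑ j, standardMultiplicity A (μ j) = n := by
  classical
  set p := (complexAdjoint A).charpoly with hp
  have hp0 : p ≠ 0 := (complexAdjoint A).charpoly_monic.ne_zero
  have htotal : ∑ z ∈ p.roots.toFinset, p.rootMultiplicity z = 2 * n := by
    simp_rw [← Polynomial.count_roots, Multiset.toFinset_sum_count_eq]
    rw [← (IsAlgClosed.splits p).natDegree_eq_card_roots, hp, Matrix.charpoly_natDegree_eq_dim]
    simp
    ring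
  have himage : Finset.univ.image μ = p.roots.toFinset.filter fun z => 0 ≤ z.im := by
    ext z
    simp [← h z, isStandardEigenvalue_iff, ← hp, hp0, and_comm]
  -- Conjugation matches the roots below the real axis with those strictly above it, so a nonreal
  -- root in the upper half-plane counts twice and a real root once.
  have hconj : ∑ z ∈ p.roots.toFinset with ¬ 0 ≤ z.im, p.rootMultiplicity z =
      ∑ z ∈ p.roots.toFinset with 0 ≤ z.im, if z.im ≠ 0 then p.rootMultiplicity z else 0 := by
    rw [← Finset.sum_filter, Finset.filter_filter]
    have hroot : ∀ z, p.IsRoot z → p.IsRoot (starRingEnd ℂ z) := fun z hz => by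
      rw [← Polynomial.rootMultiplicity_pos hp0] at hz ⊢
      rwa [rootMultiplicity_conj]
    refine Finset.sum_nbij' (starRingEnd ℂ) (starRingEnd ℂ) ?_ ?_ (by simp) (by simp) ?_
    · intro z hz
      simp only [Finset.mem_filter, Multiset.mem_toFinset, Polynomial.mem_roots hp0, not_le] at hz ⊢
      refine ⟨hroot z hz.1, ?_⟩
      simp [hz.2.le, hz.2.ne]
    · intro z hz
      simp only [Finset.mem_filter, Multiset.mem_toFinset, Polynomial.mem_roots hp0, not_le] at hz ⊢
      refine ⟨hroot z hz.1, ?_⟩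
      simpa using lt_of_le_of_ne hz.2.1 (Ne.symm hz.2.2)
    · intro z _
      exact (rootMultiplicity_conj A z).symm
  rw [← Finset.sum_filter_add_sum_filter_not _ (fun z : ℂ => 0 ≤ z.im), hconj,
    ← Finset.sum_add_distrib, ← himage, Finset.sum_image hμ.injOn] at htotal
  refine Nat.eq_of_mul_eq_mul_left two_pos ?_
  rw [← htotal, Finset.mul_sum]
  refine Finset.sum_congr rfl fun j _ => ?_
  by_cases hj : (μ j).im = 0
  · rw [if_neg (not_not.2 hj), add_zero, two_mul_standardMultiplicity_of_im_eq_zero A hj]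
  · rw [if_pos hj, standardMultiplicity, if_neg hj, two_mul]

end RightModule
end

/-! ### Quaternionic Jordan chains: existence, independence and completeness -/

noncomputable section

/-- If members of a set of pairs all have the same first component, then independence for each
fixed first component suffices. -/
theorem linearIndependent_subtype_of_fst_eq {R V ι : Type*} {α : ι → Type*} [Ring R]
    [AddCommGroup V] [Module R V] {x : (Σ j, α j) → V} {P : (Σ j, α j) → Prop}
    (hP : ∀ p q, P p → P q → p.1 = q.1) (h : ∀ j, LinearIndependent R fun a => x ⟨j, a⟩) :
    LinearIndependent R fun p : {p // P p} => x p := by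
  rcases isEmpty_or_nonempty {p // P p} with he | ⟨⟨p₀, hp₀⟩⟩
  · exact linearIndependent_empty_type
  let f : {p // P p} → α p₀.1 := fun p => hP p.1 p₀ p.2 hp₀ ▸ p.1.2
  have hf : ∀ p : {p // P p}, (⟨p₀.1, f p⟩ : Σ j, α j) = p.1 := by
    rintro ⟨⟨j, a⟩, hp⟩
    obtain ⟨j₀, a₀⟩ := p₀
    obtain rfl : j = j₀ := hP _ _ hp hp₀
    rfl
  have hinj : Function.Injective f := fun p q hpq => by
    apply Subtype.ext
    rw [← hf p, ← hf q, hpq]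
  have := (h p₀.1).comp f hinj
  simpa only [Function.comp_def, hf] using this

/-- There are at most as many independent vectors in a subspace as its dimension says. -/
theorem LinearIndependent.card_le_finrank_of_mem {K V κ : Type*} [DivisionRing K] [AddCommGroup V]
    [Module K V] [FiniteDimensional K V] [Fintype κ] {x : κ → V} (hx : LinearIndependent K x)
    {W : Submodule K V} (h : ∀ a, x a ∈ W) : Fintype.card κ ≤ Module.finrank K W :=
  (LinearIndependent.of_comp W.subtype (v := fun a => (⟨x a, h a⟩ : W)) hx).fintype_card_le_finrank

section RightModule

attribute [local instance] quaternionComplexModule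

variable {n k : ℕ} {A : Matrix (Fin n) (Fin n) ℍ[ℝ]} {μ : Fin k → ℂ}

instance finite_op_quaternion_pi (n : ℕ) : Module.Finite ℍ[ℝ]ᵐᵒᵖ (Fin n → ℍ[ℝ]) :=
  Module.Finite.of_restrictScalars_finite ℂ ℍ[ℝ]ᵐᵒᵖ _

theorem finrank_op_quaternion_pi (n : ℕ) : Module.finrank ℍ[ℝ]ᵐᵒᵖ (Fin n → ℍ[ℝ]) = n := by
  have h := Module.finrank_mul_finrank ℂ ℍ[ℝ]ᵐᵒᵖ (Fin n → ℍ[ℝ])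
  rw [finrank_complex_op, finrank_complex_quaternion_pi] at h
  omega

/-- Complex conjugation if the index is `1`, the identity if it is `0`. -/
def conjIf (b : Fin 2) (z : ℂ) : ℂ := if b = 0 then z else starRingEnd ℂ z

theorem conjIf_one (z : ℂ) : conjIf 1 z = starRingEnd ℂ z := rfl

theorem conjIf_conjIf (b : Fin 2) (z : ℂ) : conjIf b (conjIf b z) = z := by
  fin_cases b <;> simp [conjIf]

/-- This is `z j = j (conj z)`: right multiplication by `j` is conjugate linear. -/
theorem basis_smul_complex_smul (b : Fin 2) (z : ℂ) (v : Fin n → ℍ[ℝ]) :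
    quaternionComplexBasis b • z • v = conjIf b z • quaternionComplexBasis b • v := by
  ext1 i
  fin_cases b
  · simp [quaternionComplexBasis_zero, conjIf]
  · simp only [Fin.mk_one, quaternionComplexBasis_one, conjIf_one]
    change v i * (z : ℍ[ℝ]) * quaternionJ =
      v i * quaternionJ * (starRingEnd ℂ z : ℍ[ℝ])
    rw [mul_assoc, mul_assoc]
    congr 1
    have h₀ : quaternionJ.re = 0 := rfl
    have h₁ : quaternionJ.imI = 0 := rfl
    have h₂ : quaternionJ.imJ = 1 := rfl
    have h₃ : quaternionJ.imK = 0 := rfl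
    ext <;> simp [h₀, h₁, h₂, h₃]

theorem complexEnd_smul (q : ℍ[ℝ]ᵐᵒᵖ) (v : Fin n → ℍ[ℝ]) :
    complexEnd A (q • v) = q • complexEnd A v := (quaternionEnd A).map_smul q v

theorem basis_smul_injective (b : Fin 2) :
    Function.Injective fun v : Fin n → ℍ[ℝ] => quaternionComplexBasis b • v :=
  smul_right_injective _ (quaternionComplexBasis.ne_zero b)

/-- Eigenvectors for a nonreal eigenvalue that are independent over the complex numbers are
independent over the quaternions. -/
theorem linearIndependent_of_im_ne_zero {ι : Type*} [Fintype ι] {z : ℂ} (hz : z.im ≠ 0)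
    {v : ι → Fin n → ℍ[ℝ]} (hv : ∀ i, complexEnd A (v i) = z • v i)
    (h : LinearIndependent ℂ v) : LinearIndependent ℍ[ℝ]ᵐᵒᵖ v := by
  refine LinearIndependent.of_basis_smul quaternionComplexBasis ?_
  have hinj : Function.Injective fun b => conjIf b z := by
    have : starRingEnd ℂ z ≠ z := fun h => hz (Complex.conj_eq_iff_im.1 h)
    intro b c
    fin_cases b <;> fin_cases c <;> simp [conjIf, this, this.symm]
  refine iSupIndep.linearIndependent_of_fibers ((complexEnd A).eigenspaces_iSupIndep.comp hinj)
    (fun p : Fin 2 × ι => p.1) (fun p => quaternionComplexBasis p.1 • v p.2) (fun p => ?_)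
    fun b => ?_
  · refine Module.End.mem_eigenspace_iff.2 ?_
    rw [complexEnd_smul, hv, basis_smul_complex_smul]
  -- An injective conjugate linear map preserves complex independence.
  · have hb : LinearIndependent ℂ fun i => quaternionComplexBasis b • v i :=
      h.map_of_injective_injective (conjIf b)
        (DistribSMul.toAddMonoidHom _ (quaternionComplexBasis b))
        (fun r hr => by rw [← conjIf_conjIf b r, hr]; fin_cases b <;> simp [conjIf])
        (fun w hw => basis_smul_injective b (by simpa using hw))
        (fun r w => by simp [basis_smul_complex_smul, conjIf_conjIf])
    have hf : Function.Injective fun p : {p : Fin 2 × ι // p.1 = b} => p.1.2 := by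
      rintro ⟨⟨b, i⟩, rfl⟩ ⟨⟨c, i'⟩, hc⟩ h
      dsimp at h hc
      subst h hc
      rfl
    have heq : (fun p : {p : Fin 2 × ι // p.1 = b} => quaternionComplexBasis p.1.1 • v p.1.2) =
        (fun i => quaternionComplexBasis b • v i) ∘ fun p => p.1.2 :=
      funext fun p => by simp only [Function.comp_apply, p.2]
    rw [heq]
    exact hb.comp _ hf

/-- Jordan chains for one eigenvalue whose lengths add up to its multiplicity. -/
theorem exists_jordanChains_eigenvalue (A : Matrix (Fin n) (Fin n) ℍ[ℝ]) (z : ℂ) :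
    ∃ (r : ℕ) (m : Fin r → ℕ) (v : Fin r → ℕ → Fin n → ℍ[ℝ]), (∀ i, 0 < m i) ∧
      (∀ i, A.mulVec (v i 0) = rmul (v i 0) z) ∧
      (∀ i l, l + 1 < m i → A.mulVec (v i (l + 1)) - rmul (v i (l + 1)) z = v i l) ∧
      LinearIndependent ℍ[ℝ]ᵐᵒᵖ (fun i => v i 0) ∧ ∑ i, m i = standardMultiplicity A z := by
  by_cases hz : z.im = 0
  · obtain ⟨r, m, v, hm, h0, hs, hi, hsum⟩ := exists_jordanChains_ker_pow
      (quaternionEnd (A - Matrix.diagonal fun _ => (z : ℍ[ℝ]))) (2 * n)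
    simp only [quaternionEnd_sub_diagonal A hz] at h0 hs
    refine ⟨r, m, v, hm, fun i => sub_eq_zero.1 (h0 i), hs, hi, ?_⟩
    rw [hsum]
    have h₁ := finrank_ker_pow_of_im_eq_zero A hz
    have h₂ := two_mul_standardMultiplicity_of_im_eq_zero A hz
    omega
  -- For nonreal `z`, `v ↦ A v - v z` is only complex linear, so the chains are found over `ℂ` and
  -- only the independence of the eigenvectors has to be upgraded.
  · obtain ⟨r, m, v, hm, h0, hs, hi, hsum⟩ := exists_jordanChains_ker_pow
      (complexEnd A - z • 1) (2 * n)
    have h0' : ∀ i, complexEnd A (v i 0) = z • v i 0 := fun i => sub_eq_zero.1 (h0 i)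
    refine ⟨r, m, v, hm, h0', hs, linearIndependent_of_im_ne_zero hz h0' hi, ?_⟩
    rw [hsum, standardMultiplicity, if_neg hz, ← finrank_maxGenEigenspace_complexEnd,
      Module.End.maxGenEigenspace_eq_genEigenspace_finrank, Module.End.genEigenspace_nat,
      finrank_complex_quaternion_pi]

theorem JordanChains.exists_isComplete (hμ : Function.Injective μ)
    (h : ∀ z : ℂ, IsStandardEigenvalue A z ↔ ∃ j, μ j = z) :
    ∃ S : JordanChains A μ, S.IsComplete := by
  choose r m v hm h0 hs hi hsum using fun j => exists_jordanChains_eigenvalue A (μ j)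
  refine ⟨⟨r, m, hm, fun j i l => v j i l, h0, hs, hi⟩, ?_⟩
  rw [JordanChains.IsComplete]
  exact (Finset.sum_congr rfl fun j _ => hsum j).trans (sum_standardMultiplicity A hμ h)

namespace JordanChains

variable (S : JordanChains A μ)

/-- The vectors of a chain, continued by zero. -/
def vec (j : Fin k) (i : Fin (S.r j)) (l : ℕ) : Fin n → ℍ[ℝ] :=
  if h : l < S.m j i then S.v j i ⟨l, h⟩ else 0

theorem vec_coe (j : Fin k) (i : Fin (S.r j)) (l : Fin (S.m j i)) : S.vec j i l = S.v j i l := by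
  simp [vec]

theorem mulVec_vec_zero (j : Fin k) (i : Fin (S.r j)) :
    A.mulVec (S.vec j i 0) = rmul (S.vec j i 0) (μ j) := by
  simp only [vec, S.m_pos, dif_pos]
  exact S.eigenvector j i

theorem mulVec_vec_succ (j : Fin k) (i : Fin (S.r j)) (l : ℕ) (hl : l + 1 < S.m j i) :
    A.mulVec (S.vec j i (l + 1)) = rmul (S.vec j i (l + 1)) (μ j) + S.vec j i l := by
  simp only [vec, hl, Nat.lt_of_succ_lt hl, dif_pos]
  rw [← S.chain j i l hl, add_sub_cancel]

/-- Together with the successor step, this makes `j` times a chain for `μ j` a chain for the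
conjugate eigenvalue. -/
theorem complexEnd_basis_smul_vec_zero (b : Fin 2) (j : Fin k) (i : Fin (S.r j)) :
    complexEnd A (quaternionComplexBasis b • S.vec j i 0) =
      conjIf b (μ j) • quaternionComplexBasis b • S.vec j i 0 := by
  rw [complexEnd_smul, complexEnd_apply, mulVec_vec_zero, ← complex_smul_eq_rmul,
    basis_smul_complex_smul]

theorem complexEnd_basis_smul_vec_succ (b : Fin 2) (j : Fin k) (i : Fin (S.r j)) (l : ℕ)
    (hl : l + 1 < S.m j i) :
    complexEnd A (quaternionComplexBasis b • S.vec j i (l + 1)) =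
      conjIf b (μ j) • quaternionComplexBasis b • S.vec j i (l + 1) +
        quaternionComplexBasis b • S.vec j i l := by
  rw [complexEnd_smul, complexEnd_apply, mulVec_vec_succ _ _ _ _ hl, ← complex_smul_eq_rmul,
    smul_add, basis_smul_complex_smul]

theorem basis_smul_mem_maxGenEigenspace (b : Fin 2) (j : Fin k) (i : Fin (S.r j))
    (l : Fin (S.m j i)) :
    quaternionComplexBasis b • S.v j i l ∈ (complexEnd A).maxGenEigenspace (conjIf b (μ j)) := by
  rw [← vec_coe]
  exact mem_maxGenEigenspace_of_chain (complexEnd A) (conjIf b (μ j)) (S.m j i)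
    (fun l => quaternionComplexBasis b • S.vec j i l) (S.complexEnd_basis_smul_vec_zero b j i)
    (S.complexEnd_basis_smul_vec_succ b j i) l l.2

/-- The closed upper half-plane contains only one member of each conjugate pair. -/
theorem eq_of_conjIf_eq (hμ : Function.Injective μ) (him : ∀ j, 0 ≤ (μ j).im) {b c : Fin 2}
    {j j' : Fin k} (h : conjIf b (μ j) = conjIf c (μ j')) : j = j' := by
  apply hμ
  have h₁ := him j
  have h₂ := him j'
  rw [Complex.ext_iff] at h
  apply Complex.ext
  · fin_cases b <;> fin_cases c <;> simpa [conjIf] using h.1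
  · fin_cases b <;> fin_cases c <;> simp [conjIf] at h <;> linarith [h.2]

/-- All vectors of a system of Jordan chains are right independent. -/
theorem linearIndependent (hμ : Function.Injective μ) (him : ∀ j, 0 ≤ (μ j).im) :
    LinearIndependent ℍ[ℝ]ᵐᵒᵖ
      fun p : (Σ q : (Σ j, Fin (S.r j)), Fin (S.m q.1 q.2)) => S.v p.1.1 p.1.2 p.2 := by
  refine LinearIndependent.of_basis_smul quaternionComplexBasis ?_
  have h := linearIndependent_jordanChains (complexEnd A)
    (fun q : (Σ j, Fin 2 × Fin (S.r j)) => conjIf q.2.1 (μ q.1)) (fun q => S.m q.1 q.2.2)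
    (fun q l => quaternionComplexBasis q.2.1 • S.vec q.1 q.2.2 l)
    (fun q => S.complexEnd_basis_smul_vec_zero q.2.1 q.1 q.2.2)
    (fun q => S.complexEnd_basis_smul_vec_succ q.2.1 q.1 q.2.2) (fun z => by
      -- All doubled chains for one `z` come from a single `j`. Their initial vectors are among the
      -- products of `1, j` with right independent vectors, which covers real and nonreal `z` alike.
      refine linearIndependent_subtype_of_fst_eq
        (x := fun q : (Σ j, Fin 2 × Fin (S.r j)) =>
          quaternionComplexBasis q.2.1 • S.vec q.1 q.2.2 0)
        (fun p q hp hq => eq_of_conjIf_eq hμ him (hp.trans hq.symm)) fun j => ?_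
      have := linearIndependent_smul quaternionComplexBasis.linearIndependent (S.independent j)
      simpa only [vec, S.m_pos, dif_pos] using this)
  let f : Fin 2 × (Σ q : (Σ j, Fin (S.r j)), Fin (S.m q.1 q.2)) →
      Σ q : (Σ j, Fin 2 × Fin (S.r j)), Fin (S.m q.1 q.2.2) :=
    fun p => ⟨⟨p.2.1.1, p.1, p.2.1.2⟩, p.2.2⟩
  have hf : Function.LeftInverse (fun q => (q.1.2.1, ⟨⟨q.1.1, q.1.2.2⟩, q.2⟩)) f := fun _ => rfl
  have := h.comp f hf.injective
  simpa only [Function.comp_def, f, vec_coe] using this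

/-- For real `μ j` both `v` and its multiple by `j` lie in the same generalized eigenspace, and the
factor two cancels against the halved multiplicity; for nonreal `μ j` only `v` is counted. -/
theorem sum_m_le_standardMultiplicity (hμ : Function.Injective μ) (him : ∀ j, 0 ≤ (μ j).im)
    (j : Fin k) : ∑ i, S.m j i ≤ standardMultiplicity A (μ j) := by
  have hli : LinearIndependent ℍ[ℝ]ᵐᵒᵖ fun p : (Σ i, Fin (S.m j i)) => S.v j p.1 p.2 := by
    let f : (Σ i, Fin (S.m j i)) → Σ q : (Σ j, Fin (S.r j)), Fin (S.m q.1 q.2) :=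
      fun p => ⟨⟨j, p.1⟩, p.2⟩
    have hf : Function.Injective f := by
      rintro ⟨i, l⟩ ⟨i', l'⟩ h
      simp only [f, Sigma.mk.injEq, heq_eq_eq, true_and] at h
      obtain ⟨rfl, h⟩ := h
      simpa using h
    exact (S.linearIndependent hμ him).comp f hf
  have hli₂ := linearIndependent_smul quaternionComplexBasis.linearIndependent hli
  by_cases hz : (μ j).im = 0
  · have hmem : ∀ p : Fin 2 × (Σ i, Fin (S.m j i)),
        quaternionComplexBasis p.1 • S.v j p.2.1 p.2.2 ∈
          (complexEnd A).maxGenEigenspace (μ j) := fun p => by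
      have := S.basis_smul_mem_maxGenEigenspace p.1 j p.2.1 p.2.2
      rwa [conjIf, Complex.conj_eq_iff_im.2 hz, ite_self] at this
    have hle := hli₂.card_le_finrank_of_mem hmem
    rw [finrank_maxGenEigenspace_complexEnd,
      ← two_mul_standardMultiplicity_of_im_eq_zero A hz] at hle
    simpa using hle
  · have hmem : ∀ p : (Σ i, Fin (S.m j i)), quaternionComplexBasis 0 • S.v j p.1 p.2 ∈
        (complexEnd A).maxGenEigenspace (μ j) := fun p =>
      S.basis_smul_mem_maxGenEigenspace 0 j p.1 p.2
    have hle := (hli₂.comp (fun p => ((0 : Fin 2), p))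
      (Prod.mk_right_injective 0)).card_le_finrank_of_mem hmem
    rw [finrank_maxGenEigenspace_complexEnd] at hle
    rw [standardMultiplicity, if_neg hz]
    simpa using hle

variable {S}

/-- Termwise inequalities whose two sides have the same total `n` are equalities. -/
theorem IsComplete.sum_m_eq_standardMultiplicity (hS : S.IsComplete) (hμ : Function.Injective μ)
    (h : ∀ z : ℂ, IsStandardEigenvalue A z ↔ ∃ j, μ j = z) (j : Fin k) :
    ∑ i, S.m j i = standardMultiplicity A (μ j) := by
  have him : ∀ j, 0 ≤ (μ j).im := fun j => ((h _).2 ⟨j, rfl⟩).1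
  exact (Finset.sum_eq_sum_iff_of_le fun j _ => S.sum_m_le_standardMultiplicity hμ him j).1
    (hS.trans (sum_standardMultiplicity A hμ h).symm) j (Finset.mem_univ j)

/-- The vectors of a complete system of Jordan chains form a right basis. -/
def IsComplete.basis (hS : S.IsComplete) (hμ : Function.Injective μ) (him : ∀ j, 0 ≤ (μ j).im) :
    Module.Basis (Σ q : (Σ j, Fin (S.r j)), Fin (S.m q.1 q.2)) ℍ[ℝ]ᵐᵒᵖ (Fin n → ℍ[ℝ]) :=
  basisOfLinearIndependentOfCardEqFinrank' _ (S.linearIndependent hμ him) (by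
    rw [finrank_op_quaternion_pi, Fintype.card_sigma, Fintype.sum_sigma]
    simpa [IsComplete] using hS)

theorem IsComplete.basis_apply (hS : S.IsComplete) (hμ : Function.Injective μ)
    (him : ∀ j, 0 ≤ (μ j).im) (p : Σ q : (Σ j, Fin (S.r j)), Fin (S.m q.1 q.2)) :
    hS.basis hμ him p = S.v p.1.1 p.1.2 p.2 := by
  simp [basis]

theorem IsComplete.isInternal (hS : S.IsComplete) (hμ : Function.Injective μ)
    (him : ∀ j, 0 ≤ (μ j).im) :
    DirectSum.IsInternal fun p : (Σ j : Fin k, Fin (S.r j)) => S.N p.1 p.2 := by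
  classical
  refine DirectSum.isInternal_submodule_of_iSupIndep_of_iSup_eq_top ?_ ?_
  · rw [iSupIndep_iff_finsetSum_eq_zero_imp_eq_zero]
    intro s x hx hsum q hq
    have hc : ∀ q : (Σ j : Fin k, Fin (S.r j)), ∃ c : Fin (S.m q.1 q.2) → ℍ[ℝ]ᵐᵒᵖ,
        q ∈ s → ∑ l, c l • S.v q.1 q.2 l = x q := fun q => by
      by_cases hq : q ∈ s
      · obtain ⟨c, hc⟩ := (Submodule.mem_span_range_iff_exists_fun _).1 (hx q hq)
        exact ⟨c, fun _ => hc⟩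
      · exact ⟨0, fun h => absurd h hq⟩
    choose c hc using hc
    have h0 := Fintype.linearIndependent_iff.1 (S.linearIndependent hμ him)
      (fun p => if p.1 ∈ s then c p.1 p.2 else 0) (by
        rw [← hsum, Fintype.sum_sigma, ← Finset.sum_subset (Finset.subset_univ s)]
        · refine Finset.sum_congr rfl fun q hq => ?_
          rw [← hc q hq]
          simp [hq]
        · intro q _ hq
          simp [hq])
    rw [← hc q hq]
    refine Finset.sum_eq_zero fun l _ => ?_
    have := h0 ⟨q, l⟩
    rw [if_pos hq] at this
    rw [this, zero_smul]
  · rw [eq_top_iff, ← (hS.basis hμ him).span_eq, Submodule.span_le]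
    rintro _ ⟨p, rfl⟩
    rw [basis_apply]
    exact Submodule.mem_iSup_of_mem p.1 (Submodule.subset_span ⟨p.2, rfl⟩)

theorem IsComplete.existsUnique_coefficients (hS : S.IsComplete) (hμ : Function.Injective μ)
    (him : ∀ j, 0 ≤ (μ j).im) (η : Fin n → ℍ[ℝ]) :
    ∃! c : (j : Fin k) → (i : Fin (S.r j)) → Fin (S.m j i) → ℍ[ℝ],
      η = ∑ j, ∑ i, ∑ l, rmul (S.v j i l) (c j i l) := by
  have hsum : ∀ c : (j : Fin k) → (i : Fin (S.r j)) → Fin (S.m j i) → ℍ[ℝ],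
      ∑ j, ∑ i, ∑ l, rmul (S.v j i l) (c j i l) = ∑ p : (Σ q : (Σ j, Fin (S.r j)),
        Fin (S.m q.1 q.2)), MulOpposite.op (c p.1.1 p.1.2 p.2) • hS.basis hμ him p := fun c => by
    simp only [Fintype.sum_sigma, basis_apply]
  refine ⟨fun j i l => ((hS.basis hμ him).repr η ⟨⟨j, i⟩, l⟩).unop, ?_, fun c hc => ?_⟩
  · beta_reduce
    rw [hsum]
    exact ((hS.basis hμ him).sum_repr η).symm
  · beta_reduce at hc
    rw [hsum] at hc
    funext j i l
    rw [hc, (hS.basis hμ him).repr_sum_self fun p => MulOpposite.op (c p.1.1 p.1.2 p.2)]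
    rfl

end JordanChains
end RightModule
end

/-! ### The exponential and the solutions of `x' = A x` -/

noncomputable section

variable {n k : ℕ} {A : Matrix (Fin n) (Fin n) ℍ[ℝ]} {μ : Fin k → ℂ}

section Exponential

attribute [local instance] Matrix.linftyOpNormedRing Matrix.linftyOpNormedAlgebra

theorem isSolution_exp_mulVec (A : Matrix (Fin n) (Fin n) ℍ[ℝ]) (η : Fin n → ℍ[ℝ]) :
    IsSolution A fun t => (NormedSpace.exp (t • A)).mulVec η := by
  intro t
  have : FiniteDimensional ℝ (Matrix (Fin n) (Fin n) ℍ[ℝ]) :=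
    inferInstanceAs (FiniteDimensional ℝ (Fin n → Fin n → ℍ[ℝ]))
  have : CompleteSpace (Matrix (Fin n) (Fin n) ℍ[ℝ]) := FiniteDimensional.complete ℝ _
  let L : Matrix (Fin n) (Fin n) ℍ[ℝ] →ₗ[ℝ] (Fin n → ℍ[ℝ]) :=
    { toFun := fun M => M.mulVec η
      map_add' := fun M N => Matrix.add_mulVec M N η
      map_smul' := fun r M => Matrix.smul_mulVec r M η }
  have h := (LinearMap.toContinuousLinearMap L).hasFDerivAt.comp_hasDerivAt t
    (hasDerivAt_exp_smul_const' (𝕂 := ℝ) A t)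
  rw [Matrix.mulVec_mulVec]
  exact h

end Exponential

theorem IsSolution.eq_of_eq_at_zero {x y : ℝ → Fin n → ℍ[ℝ]} (hx : IsSolution A x)
    (hy : IsSolution A y) (h : x 0 = y 0) : x = y := by
  let L : (Fin n → ℍ[ℝ]) →ₗ[ℝ] (Fin n → ℍ[ℝ]) :=
    { toFun := A.mulVec
      map_add' := A.mulVec_add
      map_smul' := fun r v => A.mulVec_smul r v }
  exact ODE_solution_unique_univ (v := fun _ => A.mulVec) (s := fun _ => Set.univ)
    (fun _ => (LinearMap.toContinuousLinearMap L).lipschitz.lipschitzOnWith)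
    (fun t => ⟨hx t, trivial⟩) (fun t => ⟨hy t, trivial⟩) h

theorem IsSolution.eq_exp {x : ℝ → Fin n → ℍ[ℝ]} (hx : IsSolution A x) :
    x = fun t => (NormedSpace.exp (t • A)).mulVec (x 0) :=
  hx.eq_of_eq_at_zero (isSolution_exp_mulVec A _) (by simp)

theorem isSolution_iff_exists_exp (A : Matrix (Fin n) (Fin n) ℍ[ℝ]) (x : ℝ → Fin n → ℍ[ℝ]) :
    IsSolution A x ↔
      ∃ η : Fin n → ℍ[ℝ], ∀ t : ℝ, x t = (NormedSpace.exp (t • A)).mulVec η := by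
  refine ⟨fun hx => ⟨x 0, congrFun hx.eq_exp⟩, ?_⟩
  rintro ⟨η, h⟩
  rw [funext h]
  exact isSolution_exp_mulVec A η

theorem mulVec_rmul (A : Matrix (Fin n) (Fin n) ℍ[ℝ]) (v : Fin n → ℍ[ℝ]) (q : ℍ[ℝ]) :
    A.mulVec (rmul v q) = rmul (A.mulVec v) q :=
  A.mulVec_smul _ _

theorem rmul_rmul (v : Fin n → ℍ[ℝ]) (p q : ℍ[ℝ]) : rmul (rmul v p) q = rmul v (p * q) := by
  rw [rmul, rmul, rmul, smul_smul, MulOpposite.op_mul]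

theorem hasDerivAt_rmul {x : ℝ → Fin n → ℍ[ℝ]} {x' : Fin n → ℍ[ℝ]} {q : ℝ → ℍ[ℝ]} {q' : ℍ[ℝ]}
    {t : ℝ} (hx : HasDerivAt x x' t) (hq : HasDerivAt q q' t) :
    HasDerivAt (fun t => rmul (x t) (q t)) (rmul x' (q t) + rmul (x t) q') t := by
  rw [hasDerivAt_pi] at hx ⊢
  exact fun i => (hx i).mul hq

theorem IsSolution.rmul_const {x : ℝ → Fin n → ℍ[ℝ]} (hx : IsSolution A x) (q : ℍ[ℝ]) :
    IsSolution A fun t => rmul (x t) q := fun t => by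
  have := hasDerivAt_rmul (hx t) (hasDerivAt_const t q)
  rwa [rmul, rmul, MulOpposite.op_zero, zero_smul, add_zero, ← rmul, ← mulVec_rmul] at this

theorem IsSolution.sum {ι : Type*} {s : Finset ι} {x : ι → ℝ → Fin n → ℍ[ℝ]}
    (hx : ∀ a ∈ s, IsSolution A (x a)) : IsSolution A fun t => ∑ a ∈ s, x a t := fun t => by
  rw [Matrix.mulVec_sum]
  exact HasDerivAt.fun_sum fun a ha => hx a ha t

/-- Since `z` commutes with its exponential, it may stand on the left, where it meets the `v z` of
the chain relation. -/
theorem hasDerivAt_coe_exp (z : ℂ) (t : ℝ) :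
    HasDerivAt (fun t : ℝ => ((Complex.exp (z * (t : ℂ)) : ℂ) : ℍ[ℝ]))
      ((z : ℍ[ℝ]) * ((Complex.exp (z * (t : ℂ)) : ℂ) : ℍ[ℝ])) t := by
  have h : HasDerivAt (fun t : ℝ => Complex.exp (z * (t : ℂ)))
      (z * Complex.exp (z * (t : ℂ))) t := by
    have := ((Complex.ofRealCLM.hasDerivAt (x := t)).const_mul z).cexp
    simpa [mul_comm] using this
  have := (LinearMap.toContinuousLinearMap
    Quaternion.ofComplex.toLinearMap).hasFDerivAt.comp_hasDerivAt t h
  rw [← Quaternion.coeComplex_mul]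
  exact this

/-- The polynomial `u_l + t u_{l-1} + ⋯ + t ^ l / l! u_0`. -/
def chainPolynomial (u : ℕ → Fin n → ℍ[ℝ]) (l : ℕ) (t : ℝ) : Fin n → ℍ[ℝ] :=
  ∑ q ∈ Finset.range (l + 1), (t ^ q / (q.factorial : ℝ)) • u (l - q)

theorem chainPolynomial_at_zero (u : ℕ → Fin n → ℍ[ℝ]) (l : ℕ) : chainPolynomial u l 0 = u l := by
  rw [chainPolynomial, Finset.sum_range_succ']
  simp

theorem hasDerivAt_chainPolynomial_zero (u : ℕ → Fin n → ℍ[ℝ]) (t : ℝ) :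
    HasDerivAt (chainPolynomial u 0) 0 t := by
  have : chainPolynomial u 0 = fun _ => u 0 := by
    funext t
    simp [chainPolynomial]
  rw [this]
  exact hasDerivAt_const t _

theorem hasDerivAt_chainPolynomial_succ (u : ℕ → Fin n → ℍ[ℝ]) (l : ℕ) (t : ℝ) :
    HasDerivAt (chainPolynomial u (l + 1)) (chainPolynomial u l t) t := by
  have : chainPolynomial u (l + 1) = fun t => (∑ q ∈ Finset.range (l + 1),
      (t ^ (q + 1) / ((q + 1).factorial : ℝ)) • u (l - q)) + u (l + 1) := by
    funext t
    rw [chainPolynomial, Finset.sum_range_succ']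
    simp
  rw [this]
  refine HasDerivAt.add_const _ (HasDerivAt.fun_sum fun q _ => HasDerivAt.smul_const ?_ _)
  have h := (hasDerivAt_pow (q + 1) t).div_const ((q + 1).factorial : ℝ)
  convert h using 1
  have h₁ : (q.factorial : ℝ) ≠ 0 := Nat.cast_ne_zero.2 q.factorial_ne_zero
  have h₂ : (q : ℝ) + 1 ≠ 0 := by positivity
  rw [Nat.factorial_succ]
  push_cast
  field_simp

theorem mulVec_chainPolynomial_zero {u : ℕ → Fin n → ℍ[ℝ]} {z : ℍ[ℝ]}
    (h0 : A.mulVec (u 0) = rmul (u 0) z) (t : ℝ) :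
    A.mulVec (chainPolynomial u 0 t) = rmul (chainPolynomial u 0 t) z := by
  simpa [chainPolynomial] using h0

/-- The excess over the eigenvector equation is the previous chain polynomial, which is also the
derivative of this one. -/
theorem mulVec_chainPolynomial_succ {u : ℕ → Fin n → ℍ[ℝ]} {z : ℍ[ℝ]} {m : ℕ}
    (h0 : A.mulVec (u 0) = rmul (u 0) z)
    (hs : ∀ l, l + 1 < m → A.mulVec (u (l + 1)) = rmul (u (l + 1)) z + u l) {l : ℕ}
    (hl : l + 1 < m) (t : ℝ) :
    A.mulVec (chainPolynomial u (l + 1) t) =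
      rmul (chainPolynomial u (l + 1) t) z + chainPolynomial u l t := by
  simp only [chainPolynomial]
  rw [Finset.sum_range_succ, Matrix.mulVec_add, Matrix.mulVec_sum, rmul, smul_add,
    Finset.smul_sum, add_right_comm, ← Finset.sum_add_distrib]
  congr 1
  · refine Finset.sum_congr rfl fun q hq => ?_
    have hq : q ≤ l := Finset.mem_range_succ_iff.1 hq
    rw [Nat.succ_sub hq, Matrix.mulVec_smul, hs (l - q) (by omega), smul_add, smul_comm]
  · rw [Nat.sub_self, Matrix.mulVec_smul, h0, smul_comm]

namespace JordanChains

variable (S : JordanChains A μ)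

theorem chainSolution_eq (j : Fin k) (i : Fin (S.r j)) (l : Fin (S.m j i)) (t : ℝ) :
    S.chainSolution j i l t = rmul (chainPolynomial (S.vec j i) l t)
      ((Complex.exp (μ j * (t : ℂ)) : ℂ) : ℍ[ℝ]) := by
  rw [chainSolution]
  congr 1
  -- The two sums run over `p` and `q = l - p`, hence the reflection.
  rw [chainPolynomial, ← Finset.sum_range_reflect, Nat.range_succ_eq_Iic,
    ← Fin.map_valEmbedding_Iic, Finset.sum_map]
  refine Finset.sum_congr rfl fun p hp => ?_
  have hp : (p : ℕ) ≤ l := Fin.le_def.1 (Finset.mem_Iic.1 hp)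
  rw [Fin.valEmbedding_apply, Nat.add_sub_cancel, Nat.sub_sub_self hp, vec_coe]

theorem chainSolution_zero (j : Fin k) (i : Fin (S.r j)) (l : Fin (S.m j i)) :
    S.chainSolution j i l 0 = S.v j i l := by
  rw [chainSolution_eq, chainPolynomial_at_zero, vec_coe]
  simp [rmul]

theorem isSolution_chainSolution (j : Fin k) (i : Fin (S.r j)) (l : Fin (S.m j i)) :
    IsSolution A (S.chainSolution j i l) := by
  intro t
  rw [funext (S.chainSolution_eq j i l)]
  -- One `w` serves as derivative and as excess, so the product rule yields exactly `A x`.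
  have key : ∃ w, HasDerivAt (chainPolynomial (S.vec j i) l) w t ∧
      A.mulVec (chainPolynomial (S.vec j i) l t) =
        rmul (chainPolynomial (S.vec j i) l t) (μ j) + w := by
    obtain ⟨l, hl⟩ := l
    cases l with
    | zero =>
      refine ⟨0, hasDerivAt_chainPolynomial_zero _ _, ?_⟩
      rw [add_zero]
      exact mulVec_chainPolynomial_zero (S.mulVec_vec_zero j i) t
    | succ l =>
      exact ⟨_, hasDerivAt_chainPolynomial_succ _ _ _,
        mulVec_chainPolynomial_succ (S.mulVec_vec_zero j i) (S.mulVec_vec_succ j i) hl t⟩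
  obtain ⟨w, hw, hA⟩ := key
  convert hasDerivAt_rmul hw (hasDerivAt_coe_exp (μ j) t) using 1
  rw [mulVec_rmul, hA, ← rmul_rmul, rmul, smul_add, add_comm]

/-- Both sides solve the equation and take the value `η` at `0`. -/
theorem exp_mulVec_eq (η : Fin n → ℍ[ℝ])
    (c : (j : Fin k) → (i : Fin (S.r j)) → Fin (S.m j i) → ℍ[ℝ])
    (hη : η = ∑ j, ∑ i, ∑ l, rmul (S.v j i l) (c j i l)) (t : ℝ) :
    (NormedSpace.exp (t • A)).mulVec η =
      ∑ j, ∑ i, ∑ l, rmul (S.chainSolution j i l t) (c j i l) := by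
  have hsol : IsSolution A fun t => ∑ j, ∑ i, ∑ l, rmul (S.chainSolution j i l t) (c j i l) :=
    .sum fun j _ => .sum fun i _ => .sum fun l _ =>
      (S.isSolution_chainSolution j i l).rmul_const (c j i l)
  have h := congrFun hsol.eq_exp t
  simp only [chainSolution_zero, ← hη] at h
  exact h.symm

end JordanChains
end

theorem theorem6p4 {n : ℕ} (A : Matrix (Fin n) (Fin n) ℍ[ℝ]) :
    {z : ℂ | IsStandardEigenvalue A z}.Finite ∧
    (∀ (k : ℕ) (μ : Fin k → ℂ), Function.Injective μ →
      (∀ z : ℂ, IsStandardEigenvalue A z ↔ ∃ j, μ j = z) →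
      ∑ j, standardMultiplicity A (μ j) = n ∧
      (∃ S : JordanChains A μ, S.IsComplete) ∧
      ∀ S : JordanChains A μ, S.IsComplete →
        (∀ j, ∑ i, S.m j i = standardMultiplicity A (μ j)) ∧
        DirectSum.IsInternal (fun p : (Σ j : Fin k, Fin (S.r j)) => S.N p.1 p.2) ∧
        (∀ η : Fin n → ℍ[ℝ],
          ∃! c : (j : Fin k) → (i : Fin (S.r j)) → Fin (S.m j i) → ℍ[ℝ],
            η = ∑ j, ∑ i, ∑ l, rmul (S.v j i l) (c j i l)) ∧
        ∀ (η : Fin n → ℍ[ℝ]) (c : (j : Fin k) → (i : Fin (S.r j)) → Fin (S.m j i) → ℍ[ℝ]),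
          η = ∑ j, ∑ i, ∑ l, rmul (S.v j i l) (c j i l) →
          ∀ t : ℝ, (NormedSpace.exp (t • A)).mulVec η =
            ∑ j, ∑ i, ∑ l, rmul (S.chainSolution j i l t) (c j i l)) ∧
    (∀ x : ℝ → Fin n → ℍ[ℝ],
      IsSolution A x ↔
        ∃ η : Fin n → ℍ[ℝ], ∀ t : ℝ, x t = (NormedSpace.exp (t • A)).mulVec η) := by
  refine ⟨finite_isStandardEigenvalue A, fun k μ hμ h => ?_, isSolution_iff_exists_exp A⟩
  have him : ∀ j, 0 ≤ (μ j).im := fun j => ((h _).2 ⟨j, rfl⟩).1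
  exact ⟨sum_standardMultiplicity A hμ h, JordanChains.exists_isComplete hμ h, fun S hS =>
    ⟨hS.sum_m_eq_standardMultiplicity hμ h, hS.isInternal hμ him,
      hS.existsUnique_coefficients hμ him, S.exp_mulVec_eq⟩⟩
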